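/- All graphs are finite and simple. A cut vertex of a connected graph is a vertex whose removal makes the graph disconnected, and the Wiener index $W(G)$ of a connected graph $G$ is the sum of the distances $d_G(u,v)$ over all unordered pairs $\{u,v\}$ of vertices of $G$. For $n\ge 4$ let $L_{n,n-1}$ denote the graph on $n$ vertices obtained from the cycle $C_{n-1}$ by adding one new vertex and joining it by an edge to exactly one vertex of the cycle. Theorem. Let $n\ge 7$ and let $G$ be a connected graph on $n$ vertices with exactly one cut vertex. Then $W(G)\le W(L_{n,n-1})$, and equality holds if and only if $G\cong L_{n,n-1}$. -/

import Mathlib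

namespace WienerCut

/-- A cut vertex of `G`: a vertex whose removal leaves a disconnected graph, that is, a graph
containing two vertices that are not joined by a walk. -/
def IsCutVertex {V : Type*} (G : SimpleGraph V) (v : V) : Prop :=
  ¬ (G.induce ({v}ᶜ : Set V)).Preconnected

/-- The Wiener index: the sum of the distances over all unordered pairs of vertices. (The
diagonal pairs `s(v, v)` in `Sym2 V` contribute `0`.) -/
noncomputable def wienerIndex {V : Type*} [Fintype V] [DecidableEq V] (G : SimpleGraph V) : ℕ :=
  ∑ p : Sym2 V, Sym2.lift ⟨fun u v => G.dist u v, fun _ _ => G.dist_comm⟩ p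

/-- The graph `L_{n,g}` (for `3 ≤ g ≤ n`): a cycle `C_g` with a vertex identified with an end
vertex of a path with `n - g + 1` vertices. The cycle is `0, 1, …, g - 1`, closed up by the edge
joining `0` and `g - 1`, and the path is `g - 1, g, …, n - 1`. In particular `L_{n,n-1}` is the
cycle on `0, …, n - 2` together with the pendant edge joining `n - 2` and `n - 1`. -/
def lollipop (n g : ℕ) : SimpleGraph (Fin n) :=
  SimpleGraph.fromRel fun i j : Fin n =>
    (i : ℕ) + 1 = (j : ℕ) ∨ ((i : ℕ) = 0 ∧ (j : ℕ) + 1 = g)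

end WienerCut

namespace WienerCut

/-! Let `v` be the cut vertex and `n = m + 1`. A component of `G - v` together with `v` is a lobe
`S`. From any `u ∈ S`, every distance layer of `S` strictly between `u` and the farthest layer has
at least two vertices, because no vertex other than `v` separates `G` and `v` does not separate `S`
(`IsLobe.two_le_card_layer`). Hence the distances from `u` within `S` sum to at most `⌊|S|²/4⌋`, the
value on a cycle. Routing distances between lobes through `v` bounds `2 W(G)` by a sum of
`lobeWeight m a` over the component sizes `a` (`two_mul_wienerIndex_le_sum_pieces`). For `m ≥ 6`
that sum is largest exactly for sizes `m - 1` and `1` (`sum_lobeWeight_lt_extremal`), where it is at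
most `2 W(L)` for the lollipop `L`. Equality makes the large lobe connected and 2-regular, hence a
cycle. This yields a bijective homomorphism from `L` to `G`, and equal Wiener indices turn it into
an isomorphism. -/

lemma two_mul_wienerIndex {V : Type*} [Fintype V] [DecidableEq V] (G : SimpleGraph V) :
    2 * wienerIndex G = ∑ u, ∑ w, G.dist u w := by
  classical
  rw [wienerIndex, Finset.mul_sum, ← Fintype.sum_prod_type',
    ← Finset.sum_fiberwise (s := Finset.univ) (g := fun x : V × V => s(x.1, x.2))]
  refine Finset.sum_congr rfl fun p _ => ?_
  induction p with
  | _ a b =>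
    by_cases hab : a = b
    · subst hab
      rw [Finset.sum_eq_zero]
      · simp
      · rintro ⟨x, y⟩ hx
        have : x = a ∧ y = a := by simpa using hx
        simp [this.1, this.2]
    · have : (Finset.univ.filter fun x : V × V => s(x.1, x.2) = s(a, b)) = {(a, b), (b, a)} := by
        ext ⟨x, y⟩
        simp
      rw [this, Finset.sum_pair (by simp [hab])]
      simp [two_mul, G.dist_comm (u := b)]

/-! ### Distance layers and the quarter-square bound -/

/-- Discrete intermediate value theorem: a function rising by at most one per edge cannot skip a
value along a walk. -/
lemma exists_eq_of_reachable {X : Type*} {H : SimpleGraph X} (φ : X → ℕ)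
    (hφ : ∀ a b, H.Adj a b → φ b ≤ φ a + 1) {a b : X} (h : H.Reachable a b) {i : ℕ}
    (ha : φ a ≤ i) (hb : i ≤ φ b) : ∃ y, H.Reachable a y ∧ φ y = i := by
  obtain ⟨p⟩ := h
  induction p with
  | nil => exact ⟨_, .rfl, le_antisymm ha hb⟩
  | @cons x y z hxy p ih =>
    rcases ha.eq_or_lt with h | h
    · exact ⟨x, .rfl, h⟩
    · obtain ⟨w, hw, hi⟩ := ih ((hφ x y hxy).trans h) hb
      exact ⟨w, hxy.reachable.trans hw, hi⟩

lemma sum_range_sub_two_mul_le (p N : ℕ) : ∑ i ∈ Finset.range N, (p - 1 - 2 * i) ≤ p ^ 2 / 4 := by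
  induction p using Nat.strong_induction_on generalizing N with
  | _ p ih =>
    match p, N with
    | 0, _ => simp
    | 1, _ => simp
    | p + 2, 0 => simp
    | p + 2, N + 1 =>
      have h := ih p (by omega) N
      rw [Finset.sum_range_succ']
      have h2 : ∀ i, p + 2 - 1 - 2 * (i + 1) = p - 1 - 2 * i := fun i => by omega
      simp only [h2]
      have : (p + 2) ^ 2 / 4 = p ^ 2 / 4 + (p + 1) := by
        rw [show (p + 2) ^ 2 = p ^ 2 + (p + 1) * 4 by ring, Nat.add_mul_div_right _ _ (by norm_num)]
      omega

section Layers
variable {X : Type*} {S : Finset X} {d : X → ℕ}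

/-- Layer `0` removes one vertex and each of the layers `1, …, i` removes two as long as something
lies beyond; otherwise the left side is zero. -/
lemma card_lt_le_of_layers (h0 : (S.filter fun x => d x = 0).card = 1)
    (h2 : ∀ i, 1 ≤ i → (∃ x ∈ S, i < d x) → 2 ≤ (S.filter fun x => d x = i).card) (i : ℕ) :
    (S.filter fun x => i < d x).card ≤ S.card - 1 - 2 * i := by
  classical
  have split : ∀ i, (S.filter fun x => i + 1 < d x).card + (S.filter fun x => d x = i + 1).card =
      (S.filter fun x => i < d x).card := fun i => by
    rw [← Finset.card_union_of_disjoint, ← Finset.filter_or]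
    · congr 1; ext x; simp; omega
    · rw [Finset.disjoint_filter]; omega
  induction i with
  | zero =>
    have : (S.filter fun x => 0 < d x).card + (S.filter fun x => d x = 0).card = S.card := by
      rw [← Finset.card_union_of_disjoint, ← Finset.filter_or]
      · congr 1; ext x; simp; omega
      · rw [Finset.disjoint_filter]; omega
    omega
  | succ i ih =>
    rcases (S.filter fun x => i + 1 < d x).eq_empty_or_nonempty with h | ⟨x, hx⟩
    · simp [h]
    · have := h2 (i + 1) (by omega) ⟨x, by simpa using hx⟩
      have := split i
      omega

lemma sum_eq_sum_card_lt {N : ℕ} (hN : ∀ x ∈ S, d x ≤ N) :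
    ∑ x ∈ S, d x = ∑ i ∈ Finset.range N, (S.filter fun x => i < d x).card := by
  simp only [Finset.card_filter]
  rw [Finset.sum_comm]
  refine Finset.sum_congr rfl fun x hx => ?_
  rw [← Finset.card_filter]
  have : (Finset.range N).filter (fun i => i < d x) = Finset.range (d x) := by
    ext i; have := hN x hx; simp; omega
  simp [this]

lemma sum_le_of_layers (h0 : (S.filter fun x => d x = 0).card = 1)
    (h2 : ∀ i, 1 ≤ i → (∃ x ∈ S, i < d x) → 2 ≤ (S.filter fun x => d x = i).card) :
    ∑ x ∈ S, d x ≤ S.card ^ 2 / 4 := by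
  rw [sum_eq_sum_card_lt (N := S.sup d) fun x hx => Finset.le_sup hx]
  exact (Finset.sum_le_sum fun i _ => card_lt_le_of_layers h0 h2 i).trans
    (sum_range_sub_two_mul_le _ _)

/-- Equality forces the layer bound to be tight at `i = 1`. With `4 ≤ S.card` the bound `S.card - 3`
is positive, so truncated subtraction cannot hide a strict inequality. -/
lemma card_layer_one_of_sum_eq (h0 : (S.filter fun x => d x = 0).card = 1)
    (h2 : ∀ i, 1 ≤ i → (∃ x ∈ S, i < d x) → 2 ≤ (S.filter fun x => d x = i).card)
    (hS : 4 ≤ S.card) (hsum : ∑ x ∈ S, d x = S.card ^ 2 / 4) :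
    (S.filter fun x => d x = 1).card = 2 := by
  classical
  by_contra hne
  refine hsum.not_lt ?_
  -- Adding `2` guarantees that the index `1` lies in the range.
  rw [sum_eq_sum_card_lt (N := S.sup d + 2) fun x hx => (Finset.le_sup hx).trans (by omega)]
  refine lt_of_lt_of_le (Finset.sum_lt_sum (fun i _ => card_lt_le_of_layers h0 h2 i)
    ⟨1, by simp, ?_⟩) (sum_range_sub_two_mul_le _ (S.sup d + 2))
  have h1 := card_lt_le_of_layers h0 h2 1
  have h3 : (S.filter fun x => 1 < d x).card + ((S.filter fun x => d x = 1).card +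
      (S.filter fun x => d x = 0).card) = S.card := by
    rw [← Finset.card_union_of_disjoint, ← Finset.card_union_of_disjoint, ← Finset.filter_or,
      ← Finset.filter_or]
    · congr 1; ext x; simp; omega
    · rw [← Finset.filter_or, Finset.disjoint_filter]; omega
    · rw [Finset.disjoint_filter]; omega
  omega

end Layers

/-! ### Lobes at the cut vertex -/

section Lobe
variable {V : Type*} {G : SimpleGraph V} {v : V} {S : Finset V}

/-- `S` is a union of the vertex `v` with one connected component of `G - v`. -/
structure IsLobe (G : SimpleGraph V) (v : V) (S : Finset V) : Prop where
  mem : v ∈ S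
  eq_of_adj : ∀ x ∈ S, ∀ y ∉ S, G.Adj x y → x = v
  reachable : ∀ x ∈ S, ∀ y ∈ S, ∀ (hx : x ≠ v) (hy : y ≠ v),
    (G.induce ({v}ᶜ : Set V)).Reachable ⟨x, hx⟩ ⟨y, hy⟩

lemma IsLobe.mem_of_reachable (hS : IsLobe G v S) {x y : V} {hx : x ≠ v} {hy : y ≠ v}
    (hxS : x ∈ S) (h : (G.induce ({v}ᶜ : Set V)).Reachable ⟨x, hx⟩ ⟨y, hy⟩) : y ∈ S := by
  obtain ⟨p⟩ := h
  generalize ha : (⟨x, hx⟩ : ({v}ᶜ : Set V)) = a at p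
  generalize hb : (⟨y, hy⟩ : ({v}ᶜ : Set V)) = b at p
  have : ∀ a b : ({v}ᶜ : Set V), (G.induce ({v}ᶜ : Set V)).Walk a b → (a : V) ∈ S →
      (b : V) ∈ S := by
    intro a b p
    induction p with
    | nil => exact id
    | @cons a b c hab p ih =>
      intro h
      refine ih ?_
      by_contra hb
      exact a.2 (hS.eq_of_adj a h b hb hab)
  subst ha hb
  exact this _ _ p hxS

lemma dist_le_succ_of_adj (hG : G.Connected) (u : V) {a b : V} (h : G.Adj a b) :
    G.dist u b ≤ G.dist u a + 1 := by
  have := hG.dist_triangle (u := u) (v := a) (w := b)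
  rwa [SimpleGraph.dist_eq_one_iff_adj.mpr h] at this

open Classical in
/-- Distance to `u`, with everything outside `S` collapsed onto `v`. -/
noncomputable def collapsedDist (G : SimpleGraph V) (v : V) (S : Finset V) (u y : V) : ℕ :=
  if y ∈ S then G.dist u y else G.dist u v

/-- Edges leave `S` only at `v`, whose value is the one assigned to the outside. -/
lemma IsLobe.collapsedDist_le (hS : IsLobe G v S) (hG : G.Connected) (u : V) (a b : V)
    (h : G.Adj a b) : collapsedDist G v S u b ≤ collapsedDist G v S u a + 1 := by
  unfold collapsedDist
  split_ifs with hb ha ha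
  · exact dist_le_succ_of_adj hG u h
  · rw [hS.eq_of_adj b hb a ha h.symm]; omega
  · rw [hS.eq_of_adj a ha b hb h]; omega
  · omega

/-- Given one vertex `y₀` of the layer, a walk from `u` to `x` avoiding `y₀` must cross level `i`
elsewhere. If `y₀ = v`, the walk runs inside the component. Otherwise `G - y₀` is connected; the
walk may leave `S`, but the collapsed distance still crosses level `i`, at a vertex of `S` or at a
value attained by `v`. -/
lemma IsLobe.two_le_card_layer [DecidableEq V] (hS : IsLobe G v S) (hG : G.Connected)
    (hcut : ∀ w, w ≠ v → ¬ IsCutVertex G w) {u x : V} (hu : u ∈ S) (hx : x ∈ S) {i : ℕ}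
    (hi : 1 ≤ i) (hix : i < G.dist u x) : 2 ≤ (S.filter fun y => G.dist u y = i).card := by
  have hmem : ∀ y, collapsedDist G v S u y = i →
      ∃ z, z ∈ S ∧ G.dist u z = i ∧ (z = y ∨ z = v) := fun y hy => by
    unfold collapsedDist at hy
    split_ifs at hy with h
    · exact ⟨y, h, hy, .inl rfl⟩
    · exact ⟨v, hS.mem, hy, .inr rfl⟩
  have hu0 : collapsedDist G v S u u = 0 := by simp [collapsedDist, hu]
  have hxi : collapsedDist G v S u x = G.dist u x := by simp [collapsedDist, hx]
  obtain ⟨y₀, hy₀, hy₀i⟩ : ∃ y ∈ S, G.dist u y = i := by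
    obtain ⟨y, -, hy⟩ := exists_eq_of_reachable _ (hS.collapsedDist_le hG u) (hG.preconnected u x)
      (i := i) (by omega) (by omega)
    obtain ⟨z, hz, hzi, -⟩ := hmem y hy
    exact ⟨z, hz, hzi⟩
  have huy : u ≠ y₀ := by rintro rfl; simp at hy₀i; omega
  have hxy : x ≠ y₀ := by rintro rfl; omega
  obtain ⟨y₁, hy₁, hy₁i, hne⟩ : ∃ y ∈ S, G.dist u y = i ∧ y ≠ y₀ := by
    by_cases hyv : y₀ = v
    · subst hyv
      obtain ⟨y, hy, hyi⟩ := exists_eq_of_reachable (fun y : ({y₀}ᶜ : Set V) => G.dist u y)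
        (fun a b h => dist_le_succ_of_adj hG u h) (hS.reachable u hu x hx huy hxy)
        (i := i) (by simp) hix.le
      exact ⟨y, hS.mem_of_reachable hu hy, hyi, y.2⟩
    · have h := not_not.mp (hcut y₀ hyv) ⟨u, huy⟩ ⟨x, hxy⟩
      obtain ⟨y, -, hy⟩ := exists_eq_of_reachable
        (fun y : ({y₀}ᶜ : Set V) => collapsedDist G v S u y)
        (fun a b h => hS.collapsedDist_le hG u a b h) h (i := i) (by simp [hu0])
        (by simp only [hxi]; omega)
      obtain ⟨z, hz, hzi, rfl | rfl⟩ := hmem y hy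
      · exact ⟨_, hz, hzi, y.2⟩
      · exact ⟨_, hz, hzi, Ne.symm hyv⟩
  calc 2 = ({y₀, y₁} : Finset V).card := (Finset.card_pair hne.symm).symm
    _ ≤ _ := Finset.card_le_card fun z hz => by
      rcases Finset.mem_insert.mp hz with rfl | hz
      · simp [*]
      · rw [Finset.mem_singleton] at hz; subst hz; simp [*]

lemma card_filter_dist_eq_zero (hG : G.Connected) {u : V} (hu : u ∈ S) :
    (S.filter fun y => G.dist u y = 0).card = 1 := by
  classical
  rw [Finset.card_eq_one]
  exact ⟨u, by ext y; simp only [hG.dist_eq_zero_iff, Finset.mem_filter, Finset.mem_singleton]; grind⟩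

lemma IsLobe.sum_dist_le (hS : IsLobe G v S) (hG : G.Connected)
    (hcut : ∀ w, w ≠ v → ¬ IsCutVertex G w) {u : V} (hu : u ∈ S) :
    ∑ w ∈ S, G.dist u w ≤ S.card ^ 2 / 4 := by
  classical
  exact sum_le_of_layers (card_filter_dist_eq_zero hG hu)
    fun i hi ⟨x, hx, h⟩ => hS.two_le_card_layer hG hcut hu hx hi h

lemma IsLobe.card_adj_of_sum_dist_eq [DecidableRel G.Adj] (hS : IsLobe G v S) (hG : G.Connected)
    (hcut : ∀ w, w ≠ v → ¬ IsCutVertex G w) {u : V} (hu : u ∈ S) (hS4 : 4 ≤ S.card)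
    (hsum : ∑ w ∈ S, G.dist u w = S.card ^ 2 / 4) : (S.filter fun w => G.Adj u w).card = 2 := by
  classical
  simpa only [SimpleGraph.dist_eq_one_iff_adj] using
    card_layer_one_of_sum_eq (card_filter_dist_eq_zero hG hu)
    (fun i hi ⟨x, hx, h⟩ => hS.two_le_card_layer hG hcut hu hx hi h) hS4 hsum

end Lobe

/-! ### Optimising the component sizes -/

/-- The largest contribution of a component with `a` vertices of `G - v` to twice the Wiener
index, where `G` has `m + 1` vertices. -/
def lobeWeight (m a : ℕ) : ℕ := (a + 1) ^ 2 / 4 * (2 * m + 1 - a)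

lemma lobeWeight_even (m x : ℕ) : lobeWeight m (2 * x) = x * (x + 1) * (2 * m + 1 - 2 * x) := by
  rw [lobeWeight, show (2 * x + 1) ^ 2 = 1 + (x * (x + 1)) * 4 by ring,
    Nat.add_mul_div_right _ _ (by norm_num)]
  simp

lemma lobeWeight_odd (m x : ℕ) : lobeWeight m (2 * x + 1) = (x + 1) ^ 2 * (2 * m - 2 * x) := by
  rw [lobeWeight, show (2 * x + 1 + 1) ^ 2 = (x + 1) ^ 2 * 4 by ring,
    Nat.mul_div_cancel _ (by norm_num)]
  congr 1
  omega

lemma lobeWeight_one (m : ℕ) : lobeWeight m 1 = 2 * m := by simp [lobeWeight]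

lemma lobeWeight_pred {m : ℕ} (hm : 1 ≤ m) : lobeWeight m (m - 1) = m ^ 2 / 4 * (m + 2) := by
  rw [lobeWeight, Nat.sub_add_cancel hm]
  congr 1
  omega

/-- Splitting by parity removes the floor, and after the shifts the difference is a polynomial with
nonnegative coefficients. The case `a = b = 1` is excluded since there the left side is larger by
`2`. -/
lemma lobeWeight_add_le {m a b : ℕ} (ha : 1 ≤ a) (hb : 1 ≤ b) (hab : 3 ≤ a + b)
    (hm : a + b < m) : lobeWeight m a + lobeWeight m b ≤ lobeWeight m (a + b) := by
  obtain ⟨k, rfl⟩ : ∃ k, m = a + b + 1 + k := ⟨m - (a + b + 1), by omega⟩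
  clear hm
  obtain ⟨x, rfl | rfl⟩ := a.even_or_odd' <;> obtain ⟨y, rfl | rfl⟩ := b.even_or_odd'
  · obtain ⟨x, rfl⟩ : ∃ x', x = x' + 1 := ⟨x - 1, by omega⟩
    obtain ⟨y, rfl⟩ : ∃ x', y = x' + 1 := ⟨y - 1, by omega⟩
    rw [← mul_add, lobeWeight_even, lobeWeight_even, lobeWeight_even]
    zify [show 2 * (x + 1) ≤ 2 * (2 * (x + 1 + (y + 1)) + 1 + k) + 1 by omega,
      show 2 * (y + 1) ≤ 2 * (2 * (x + 1 + (y + 1)) + 1 + k) + 1 by omega,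
      show 2 * (x + 1 + (y + 1)) ≤ 2 * (2 * (x + 1 + (y + 1)) + 1 + k) + 1 by omega]
    rw [← sub_nonneg]
    ring_nf
    positivity
  · obtain ⟨x, rfl⟩ : ∃ x', x = x' + 1 := ⟨x - 1, by omega⟩
    rw [← add_assoc, ← mul_add, lobeWeight_even, lobeWeight_odd, lobeWeight_odd]
    zify [show 2 * (x + 1) ≤ 2 * (2 * (x + 1 + y) + 1 + 1 + k) + 1 by omega,
      show 2 * y ≤ 2 * (2 * (x + 1 + y) + 1 + 1 + k) by omega,
      show 2 * (x + 1 + y) ≤ 2 * (2 * (x + 1 + y) + 1 + 1 + k) by omega]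
    rw [← sub_nonneg]
    ring_nf
    positivity
  · obtain ⟨y, rfl⟩ : ∃ x', y = x' + 1 := ⟨y - 1, by omega⟩
    rw [show 2 * x + 1 + 2 * (y + 1) = 2 * (x + (y + 1)) + 1 by ring, lobeWeight_even, lobeWeight_odd, lobeWeight_odd]
    zify [show 2 * (y + 1) ≤ 2 * (2 * (x + (y + 1)) + 1 + 1 + k) + 1 by omega,
      show 2 * x ≤ 2 * (2 * (x + (y + 1)) + 1 + 1 + k) by omega,
      show 2 * (x + (y + 1)) ≤ 2 * (2 * (x + (y + 1)) + 1 + 1 + k) by omega]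
    rw [← sub_nonneg]
    ring_nf
    positivity
  · rw [show 2 * x + 1 + (2 * y + 1) = 2 * (x + y + 1) by ring, lobeWeight_even, lobeWeight_odd,
      lobeWeight_odd]
    zify [show 2 * (x + y + 1) ≤ 2 * (2 * (x + y + 1) + 1 + k) + 1 by omega,
      show 2 * y ≤ 2 * (2 * (x + y + 1) + 1 + k) by omega,
      show 2 * x ≤ 2 * (2 * (x + y + 1) + 1 + k) by omega]
    rw [← sub_nonneg]
    -- At `x = y = 0` the difference is negative, so one of the two variables has to be shifted.
    rcases Nat.eq_zero_or_pos x with rfl | hx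
    · obtain ⟨y, rfl⟩ : ∃ x', y = x' + 1 := ⟨y - 1, by omega⟩
      push_cast
      ring_nf
      positivity
    · obtain ⟨x, rfl⟩ : ∃ x', x = x' + 1 := ⟨x - 1, by omega⟩
      push_cast
      ring_nf
      positivity

/-- The margin `2` absorbs the error term of `sum_lobeWeight_le`. For sizes `2` and `3` the two
sides agree, whence `6 ≤ a + b`. -/
lemma lobeWeight_add_lt_extremal {a b : ℕ} (ha : 2 ≤ a) (hb : 2 ≤ b) (hab : 6 ≤ a + b) :
    lobeWeight (a + b) a + lobeWeight (a + b) b + 2 <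
      lobeWeight (a + b) (a + b - 1) + lobeWeight (a + b) 1 := by
  wlog hle : a ≤ b generalizing a b
  · have := this hb ha (by omega) (by omega)
    rwa [add_comm b a, add_comm (lobeWeight _ b)] at this
  rw [lobeWeight_one]
  obtain ⟨x, rfl | rfl⟩ := a.even_or_odd' <;> obtain ⟨y, rfl | rfl⟩ := b.even_or_odd'
  · obtain ⟨x, rfl⟩ : ∃ x', x = x' + 1 := ⟨x - 1, by omega⟩
    -- From `a ≤ b`, `6 ≤ a + b` and `b` even it follows that `b ≥ 4`.
    obtain ⟨y, rfl⟩ : ∃ x', y = x' + 2 := ⟨y - 2, by omega⟩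
    rw [show 2 * (x + 1) + 2 * (y + 2) - 1 = 2 * (x + y + 2) + 1 by omega, lobeWeight_even,
      lobeWeight_even, lobeWeight_odd]
    zify [show 2 * (x + 1) ≤ 2 * (2 * (x + 1) + 2 * (y + 2)) + 1 by omega,
      show 2 * (y + 2) ≤ 2 * (2 * (x + 1) + 2 * (y + 2)) + 1 by omega,
      show 2 * (x + y + 2) ≤ 2 * (2 * (x + 1) + 2 * (y + 2)) by omega]
    rw [← sub_pos]
    ring_nf
    positivity
  · obtain ⟨x, rfl⟩ : ∃ x', x = x' + 1 := ⟨x - 1, by omega⟩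
    obtain ⟨y, rfl⟩ : ∃ x', y = x' + 2 := ⟨y - 2, by omega⟩
    rw [show 2 * (x + 1) + (2 * (y + 2) + 1) - 1 = 2 * (x + y + 3) by omega, lobeWeight_even,
      lobeWeight_even, lobeWeight_odd]
    zify [show 2 * (x + 1) ≤ 2 * (2 * (x + 1) + (2 * (y + 2) + 1)) + 1 by omega,
      show 2 * (y + 2) ≤ 2 * (2 * (x + 1) + (2 * (y + 2) + 1)) by omega,
      show 2 * (x + y + 3) ≤ 2 * (2 * (x + 1) + (2 * (y + 2) + 1)) + 1 by omega]
    rw [← sub_pos]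
    ring_nf
    positivity
  · obtain ⟨x, rfl⟩ : ∃ x', x = x' + 1 := ⟨x - 1, by omega⟩
    obtain ⟨y, rfl⟩ : ∃ x', y = x' + 2 := ⟨y - 2, by omega⟩
    rw [show (2 * (x + 1) + 1) + 2 * (y + 2) - 1 = 2 * (x + y + 3) by omega, lobeWeight_even,
      lobeWeight_even, lobeWeight_odd]
    zify [show 2 * (x + 1) ≤ 2 * (2 * (x + 1) + 1 + 2 * (y + 2)) by omega,
      show 2 * (y + 2) ≤ 2 * (2 * (x + 1) + 1 + 2 * (y + 2)) + 1 by omega,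
      show 2 * (x + y + 3) ≤ 2 * (2 * (x + 1) + 1 + 2 * (y + 2)) + 1 by omega]
    rw [← sub_pos]
    ring_nf
    positivity
  · obtain ⟨x, rfl⟩ : ∃ x', x = x' + 1 := ⟨x - 1, by omega⟩
    obtain ⟨y, rfl⟩ : ∃ x', y = x' + 1 := ⟨y - 1, by omega⟩
    rw [show (2 * (x + 1) + 1) + (2 * (y + 1) + 1) - 1 = 2 * (x + y + 2) + 1 by omega,
      lobeWeight_odd, lobeWeight_odd, lobeWeight_odd]
    zify [show 2 * (x + 1) ≤ 2 * (2 * (x + 1) + 1 + (2 * (y + 1) + 1)) by omega,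
      show 2 * (y + 1) ≤ 2 * (2 * (x + 1) + 1 + (2 * (y + 1) + 1)) by omega,
      show 2 * (x + y + 2) ≤ 2 * (2 * (x + 1) + 1 + (2 * (y + 1) + 1)) by omega]
    rw [← sub_pos]
    ring_nf
    positivity

/-- Superadditivity fails only for `1 + 1`, by `2`. When components are merged one at a time, this
can happen only at the first merge. -/
lemma sum_lobeWeight_le {ι : Type*} {m : ℕ} (s : Finset ι) (a : ι → ℕ) (hs : s.Nonempty)
    (ha : ∀ i ∈ s, 1 ≤ a i) (hm : ∑ i ∈ s, a i < m) :
    ∑ i ∈ s, lobeWeight m (a i) ≤ lobeWeight m (∑ i ∈ s, a i) + 2 := by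
  induction hs using Finset.Nonempty.cons_induction with
  | singleton i => simp
  | cons i s hi hs ih =>
    rw [Finset.sum_cons] at hm ⊢
    rw [Finset.sum_cons]
    have h1 := ih (fun j hj => ha j (by simp [hj])) (by omega)
    have hai : 1 ≤ a i := ha i (by simp)
    have hpos : 1 ≤ ∑ j ∈ s, a j := by
      obtain ⟨j, hj⟩ := hs
      exact (ha j (by simp [hj])).trans (Finset.single_le_sum (fun _ _ => Nat.zero_le _) hj)
    by_cases h3 : 3 ≤ a i + ∑ j ∈ s, a j
    · have := lobeWeight_add_le hai hpos h3 hm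
      omega
    · have h1i : a i = 1 := by omega
      have h1s : ∑ j ∈ s, a j = 1 := by omega
      have hcard : s.card ≤ 1 := h1s ▸ by
        simpa using Finset.card_nsmul_le_sum s a 1 fun j hj => ha j (by simp [hj])
      obtain ⟨j, rfl⟩ := Finset.card_eq_one.mp
        (le_antisymm hcard (Finset.card_pos.mpr hs))
      rw [Finset.sum_singleton] at h1s
      rw [Finset.sum_singleton, Finset.sum_singleton, h1i, h1s]
      rw [lobeWeight_one, show 1 + 1 = 2 * 1 by rfl, lobeWeight_even]
      omega

/-- One component of size at least two is kept and all others are merged, which reduces to two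
sizes. The remaining case has all sizes equal to one. -/
lemma sum_lobeWeight_lt_extremal {ι : Type*} [DecidableEq ι] {m : ℕ} (s : Finset ι) (a : ι → ℕ)
    (hm6 : 6 ≤ m) (ha : ∀ i ∈ s, 1 ≤ a i) (hlt : ∀ i ∈ s, a i < m - 1)
    (hm : ∑ i ∈ s, a i = m) :
    ∑ i ∈ s, lobeWeight m (a i) < lobeWeight m (m - 1) + lobeWeight m 1 := by
  by_cases h : ∃ i ∈ s, 2 ≤ a i
  · obtain ⟨i, hi, h2⟩ := h
    have hsum := Finset.add_sum_erase s a hi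
    have hsumw := Finset.add_sum_erase s (fun i => lobeWeight m (a i)) hi
    have := hlt i hi
    have hne : (s.erase i).Nonempty := by
      by_contra hne
      rw [Finset.not_nonempty_iff_eq_empty] at hne
      rw [hne, Finset.sum_empty] at hsum
      omega
    have h1 := sum_lobeWeight_le (m := m) (s.erase i) a hne
      (fun j hj => ha j (Finset.mem_of_mem_erase hj)) (by omega)
    have h3 := lobeWeight_add_lt_extremal (a := a i) (b := ∑ j ∈ s.erase i, a j) h2 (by omega)
      (by omega)
    rw [hsum, hm] at h3
    omega
  · push Not at h
    have h1 : ∀ i ∈ s, a i = 1 := fun i hi => by have := h i hi; have := ha i hi; omega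
    rw [Finset.sum_congr rfl fun i hi => by rw [h1 i hi]]
    rw [Finset.sum_congr rfl h1] at hm
    simp only [Finset.sum_const, smul_eq_mul, mul_one] at hm ⊢
    rw [hm, lobeWeight_one, lobeWeight_pred (by omega)]
    have h4 : m * 2 ≤ m ^ 2 / 4 + 3 := by
      -- This is `(m - 2) * (m - 6) ≥ 0`.
      have : 4 * (m * 2) ≤ m ^ 2 + 12 := by nlinarith
      omega
    nlinarith [Nat.div_mul_le_self (m ^ 2) 4]

/-! ### Distances in the cycle and the lollipop -/

lemma sum_range_min_sub (m : ℕ) : ∑ k ∈ Finset.range m, min k (m - k) = m ^ 2 / 4 := by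
  induction m using Nat.strong_induction_on with
  | _ m ih =>
    match m with
    | 0 => simp
    | 1 => simp
    | m + 2 =>
      rw [Finset.sum_range_succ']
      have h2 : ∀ i ∈ Finset.range (m + 1), min (i + 1) (m + 2 - (i + 1)) = 1 + min i (m - i) := by
        intro i hi
        rw [Finset.mem_range] at hi
        omega
      rw [Finset.sum_congr rfl h2, Finset.sum_add_distrib, Finset.sum_range_succ (n := m)
        (f := fun i => min i (m - i)), ih m (by omega)]
      have : (m + 2) ^ 2 / 4 = m ^ 2 / 4 + (m + 1) := by
        rw [show (m + 2) ^ 2 = m ^ 2 + (m + 1) * 4 by ring, Nat.add_mul_div_right _ _ (by norm_num)]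
      simp [this]
      omega

/-- The graph distance on the cycle `ZMod m`. -/
def cycDist (m : ℕ) (a b : ZMod m) : ℕ := (b - a).valMinAbs.natAbs

lemma cycDist_triangle {m : ℕ} (a b c : ZMod m) : cycDist m a c ≤ cycDist m a b + cycDist m b c := by
  have := ZMod.natAbs_valMinAbs_add_le (b - a) (c - b)
  rw [sub_add_sub_comm, add_comm b, add_sub_add_right_eq_sub] at this
  exact this.trans (Int.natAbs_add_le _ _)

lemma cycDist_self {m : ℕ} (a : ZMod m) : cycDist m a a = 0 := by simp [cycDist]

lemma cycDist_comm {m : ℕ} (a b : ZMod m) : cycDist m a b = cycDist m b a := by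
  rw [cycDist, ← ZMod.natAbs_valMinAbs_neg, neg_sub, cycDist]

lemma cycDist_succ_le {m : ℕ} (hm : 2 ≤ m) (a : ZMod m) : cycDist m a (a + 1) ≤ 1 := by
  have : NeZero m := ⟨by omega⟩
  have : Fact (1 < m) := ⟨by omega⟩
  rw [cycDist, add_sub_cancel_left, ZMod.valMinAbs_natAbs_eq_min, ZMod.val_one]
  exact min_le_left _ _

lemma sum_cycDist {m : ℕ} [NeZero m] (a : ZMod m) : ∑ b, cycDist m a b = m ^ 2 / 4 := by
  rw [← sum_range_min_sub, ← Equiv.sum_comp (Equiv.addRight a)]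
  simp only [cycDist, Equiv.coe_addRight, add_sub_cancel_right, ZMod.valMinAbs_natAbs_eq_min]
  refine Finset.sum_bij (fun x _ => x.val) (fun x _ => by simpa using x.val_lt)
    (fun x _ y _ h => ZMod.val_injective m h) (fun k hk => ?_) (fun _ _ => rfl)
  exact ⟨(k : ZMod m), Finset.mem_univ _, ZMod.val_cast_of_lt (Finset.mem_range.mp hk)⟩

/-- Sends the pendant vertex of `lollipop (m + 1) m` to its neighbour. -/
def toCycle (m : ℕ) (i : Fin (m + 1)) : ZMod m := if (i : ℕ) = m then -1 else (i : ℕ)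

/-- A lower bound for the distance in `lollipop (m + 1) m`. -/
def lollipopDist (m : ℕ) (i j : Fin (m + 1)) : ℕ :=
  cycDist m (toCycle m i) (toCycle m j) + if ((i : ℕ) = m ↔ (j : ℕ) = m) then 0 else 1

/-- The pendant edge is contracted by `toCycle` and only changes the indicator; a cycle edge keeps
the indicator and moves by at most one step. -/
lemma lollipopDist_le_succ {m : ℕ} (hm : 2 ≤ m) (u i j : Fin (m + 1))
    (h : (i : ℕ) + 1 = j ∨ ((i : ℕ) = 0 ∧ (j : ℕ) + 1 = m)) :
    lollipopDist m u i ≤ lollipopDist m u j + 1 ∧ lollipopDist m u j ≤ lollipopDist m u i + 1 := by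
  have hj := j.2
  unfold lollipopDist
  have key : toCycle m j = toCycle m i ∧ (j : ℕ) = m ∧ (i : ℕ) ≠ m ∨
      cycDist m (toCycle m i) (toCycle m j) ≤ 1 ∧ (j : ℕ) ≠ m ∧ (i : ℕ) ≠ m := by
    rcases h with h | ⟨h0, h⟩
    · by_cases hjm : (j : ℕ) = m
      · left
        refine ⟨?_, hjm, by omega⟩
        rw [toCycle, toCycle, if_pos hjm, if_neg (by omega), eq_comm, eq_neg_iff_add_eq_zero]
        have : ((i + 1 : ℕ) : ZMod m) = 0 := by rw [h, hjm]; simp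
        exact_mod_cast this
      · right
        refine ⟨?_, hjm, by omega⟩
        rw [toCycle, toCycle, if_neg hjm, if_neg (by omega), ← h, Nat.cast_succ]
        exact cycDist_succ_le hm _
    · right
      refine ⟨?_, by omega, by omega⟩
      rw [toCycle, toCycle, if_neg (by omega), if_neg (by omega), h0, cycDist_comm]
      have : ((j + 1 : ℕ) : ZMod m) = 0 := by rw [h]; simp
      have h1 := cycDist_succ_le hm ((j : ℕ) : ZMod m)
      rw [show ((j : ℕ) : ZMod m) + 1 = 0 by exact_mod_cast this] at h1
      simpa using h1
  rcases key with ⟨h1, h2, h3⟩ | ⟨h1, h2, h3⟩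
  · rw [h1]
    constructor <;> split_ifs <;> omega
  · have t1 := cycDist_triangle (toCycle m u) (toCycle m i) (toCycle m j)
    have t2 := cycDist_triangle (toCycle m u) (toCycle m j) (toCycle m i)
    rw [cycDist_comm (toCycle m j)] at t2
    simp only [h2, h3, iff_false]
    constructor <;> omega

lemma lollipop_adj_iff {n g : ℕ} {i j : Fin n} : (lollipop n g).Adj i j ↔ i ≠ j ∧
    (((i : ℕ) + 1 = j ∨ ((i : ℕ) = 0 ∧ (j : ℕ) + 1 = g)) ∨
      ((j : ℕ) + 1 = i ∨ ((j : ℕ) = 0 ∧ (i : ℕ) + 1 = g))) := by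
  simp [lollipop, SimpleGraph.fromRel_adj]

lemma lollipop_connected (m g : ℕ) : (lollipop (m + 1) g).Connected := by
  have : ∀ k (hk : k < m + 1), (lollipop (m + 1) g).Reachable 0 ⟨k, hk⟩ := by
    intro k
    induction k with
    | zero => intro _; exact .rfl
    | succ k ih =>
      intro hk
      refine (ih (by omega)).trans (SimpleGraph.Adj.reachable ?_)
      rw [lollipop_adj_iff]
      exact ⟨by simp, by simp⟩
  exact SimpleGraph.connected_iff_exists_forall_reachable _ |>.mpr ⟨0, fun i => this i i.2⟩

lemma lollipopDist_le_dist {m : ℕ} (hm : 2 ≤ m) (i j : Fin (m + 1)) :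
    lollipopDist m i j ≤ (lollipop (m + 1) m).dist i j := by
  obtain ⟨p, hp⟩ := (lollipop_connected m m).exists_walk_length_eq_dist i j
  rw [← hp]
  clear hp
  have key : ∀ a b (p : (lollipop (m + 1) m).Walk a b),
      lollipopDist m i b ≤ lollipopDist m i a + p.length := by
    intro a b p
    induction p with
    | nil => simp
    | @cons a b c hab p ih =>
      rw [SimpleGraph.Walk.length_cons]
      rcases (lollipop_adj_iff.mp hab).2 with h | h
      · have := (lollipopDist_le_succ hm i _ _ h).2; omega
      · have := (lollipopDist_le_succ hm i _ _ h).1; omega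
  simpa [lollipopDist, cycDist_self] using key i j p

lemma sum_cycDist_castSucc {m : ℕ} [NeZero m] (a : ZMod m) :
    ∑ j : Fin m, cycDist m a (toCycle m j.castSucc) = m ^ 2 / 4 := by
  rw [← sum_cycDist a]
  refine Fintype.sum_bijective (fun j : Fin m => toCycle m j.castSucc) ?_ _ _ fun _ => rfl
  rw [Fintype.bijective_iff_injective_and_card]
  refine ⟨fun i j h => ?_, by simp [ZMod.card]⟩
  simp only [toCycle, Fin.val_castSucc, i.2.ne, j.2.ne, if_false] at h
  have := congrArg ZMod.val h
  rw [ZMod.val_cast_of_lt i.2, ZMod.val_cast_of_lt j.2] at this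
  exact Fin.ext this

/-- A lower bound suffices, as it meets the upper bound for `G`. The cycle gives `m` rows of `m ^ 2
/ 4`; the row and the column of the pendant vertex give `m ^ 2 / 4 + m` each. -/
lemma le_two_mul_wienerIndex_lollipop {m : ℕ} (hm : 2 ≤ m) :
    m ^ 2 / 4 * (m + 2) + 2 * m ≤ 2 * wienerIndex (lollipop (m + 1) m) := by
  have : NeZero m := ⟨by omega⟩
  rw [two_mul_wienerIndex]
  refine le_trans (le_of_eq ?_) (Finset.sum_le_sum fun i _ => Finset.sum_le_sum fun j _ =>
    lollipopDist_le_dist hm i j)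
  have hc : ∀ i : Fin m, ∑ j : Fin m, lollipopDist m i.castSucc j.castSucc = m ^ 2 / 4 := by
    intro i
    rw [← sum_cycDist_castSucc (toCycle m i.castSucc)]
    refine Finset.sum_congr rfl fun j _ => ?_
    simp [lollipopDist, i.2.ne, j.2.ne]
  have hl : ∑ j : Fin m, lollipopDist m (Fin.last m) j.castSucc = m ^ 2 / 4 + m := by
    rw [← sum_cycDist_castSucc (toCycle m (Fin.last m))]
    have : ∀ j : Fin m, lollipopDist m (Fin.last m) j.castSucc =
        cycDist m (toCycle m (Fin.last m)) (toCycle m j.castSucc) + 1 := fun j => by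
      simp [lollipopDist, j.2.ne]
    simp [this, Finset.sum_add_distrib]
  have hr : ∑ j : Fin m, lollipopDist m j.castSucc (Fin.last m) = m ^ 2 / 4 + m := by
    rw [← hl]
    refine Finset.sum_congr rfl fun j _ => ?_
    simp only [lollipopDist, cycDist_comm (toCycle m j.castSucc)]
    congr 2
    exact propext (Iff.comm)
  simp only [Fin.sum_univ_castSucc, Finset.sum_add_distrib, hc, hl, hr]
  simp [lollipopDist, cycDist_self]
  ring

/-! ### Splitting the Wiener index over the components of `G - v` -/

section Decomposition
variable {V : Type*} [Fintype V] [DecidableEq V] (G : SimpleGraph V) (v : V)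

/-- The connected components of `G - v`. -/
abbrev Piece : Type _ := (G.induce ({v}ᶜ : Set V)).ConnectedComponent

variable {G v}

open Classical in
/-- The vertices of a connected component of `G - v`. -/
noncomputable def Piece.verts (C : Piece G v) : Finset V :=
  Finset.univ.filter fun u => ∃ h : u ≠ v, (G.induce ({v}ᶜ : Set V)).connectedComponentMk ⟨u, h⟩ = C

/-- A connected component of `G - v` together with `v`. -/
noncomputable def Piece.lobe (C : Piece G v) : Finset V := insert v C.verts

lemma Piece.mem_verts {C : Piece G v} {u : V} : u ∈ C.verts ↔
    ∃ h : u ≠ v, (G.induce ({v}ᶜ : Set V)).connectedComponentMk ⟨u, h⟩ = C := by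
  simp [Piece.verts]

lemma Piece.self_notMem_verts (C : Piece G v) : v ∉ C.verts := fun h =>
  (Piece.mem_verts.mp h).1 rfl

lemma Piece.card_lobe (C : Piece G v) : C.lobe.card = C.verts.card + 1 :=
  Finset.card_insert_of_notMem C.self_notMem_verts

lemma Piece.one_le_card_verts (C : Piece G v) : 1 ≤ C.verts.card := by
  obtain ⟨⟨u, hu⟩, rfl⟩ := C.exists_rep
  exact Finset.card_pos.mpr ⟨u, Piece.mem_verts.mpr ⟨hu, rfl⟩⟩

lemma Piece.isLobe (C : Piece G v) : IsLobe G v C.lobe where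
  mem := Finset.mem_insert_self _ _
  eq_of_adj x hx y hy h := by
    by_contra hxv
    have hyv : y ≠ v := by rintro rfl; exact hy (Finset.mem_insert_self _ _)
    obtain ⟨_, rfl⟩ := Piece.mem_verts.mp (Finset.mem_of_mem_insert_of_ne hx hxv)
    refine hy (Finset.mem_insert_of_mem (Piece.mem_verts.mpr ⟨hyv, ?_⟩))
    rw [SimpleGraph.ConnectedComponent.eq]
    exact SimpleGraph.Adj.reachable (by simpa using h.symm)
  reachable x hx y hy hxv hyv := by
    obtain ⟨_, hx⟩ := Piece.mem_verts.mp (Finset.mem_of_mem_insert_of_ne hx hxv)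
    obtain ⟨_, hy⟩ := Piece.mem_verts.mp (Finset.mem_of_mem_insert_of_ne hy hyv)
    exact SimpleGraph.ConnectedComponent.eq.mp (hx.trans hy.symm)

lemma Piece.sum_dist_center (C : Piece G v) :
    ∑ w ∈ C.verts, G.dist v w = ∑ w ∈ C.lobe, G.dist v w := by
  rw [Piece.lobe, Finset.sum_insert C.self_notMem_verts, SimpleGraph.dist_self, zero_add]

lemma Piece.sum_dist_center_le (hG : G.Connected)
    (hcut : ∀ w, w ≠ v → ¬ IsCutVertex G w) (C : Piece G v) :
    ∑ w ∈ C.verts, G.dist v w ≤ (C.verts.card + 1) ^ 2 / 4 := by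
  rw [C.sum_dist_center, ← C.card_lobe]
  exact C.isLobe.sum_dist_le hG hcut C.isLobe.mem

lemma Piece.sum_sum_dist_le (hG : G.Connected)
    (hcut : ∀ w, w ≠ v → ¬ IsCutVertex G w) (C : Piece G v) :
    ∑ u ∈ C.verts, ∑ w ∈ C.lobe, G.dist u w ≤
    C.verts.card * ((C.verts.card + 1) ^ 2 / 4) := by
  rw [← smul_eq_mul, ← C.card_lobe]
  exact Finset.sum_le_card_nsmul _ _ _ fun u hu =>
    C.isLobe.sum_dist_le hG hcut (Finset.mem_insert_of_mem hu)

variable [Fintype (Piece G v)]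

lemma sum_erase_eq_sum_pieces (F : V → ℕ) :
    ∑ u ∈ Finset.univ.erase v, F u = ∑ C : Piece G v, ∑ u ∈ C.verts, F u := by
  rw [← Finset.sum_biUnion]
  · refine Finset.sum_congr ?_ fun _ _ => rfl
    ext u
    simp [Piece.mem_verts]
  · intro C _ C' _ hne
    rw [Function.onFun, Finset.disjoint_left]
    intro u hu hu'
    obtain ⟨_, h⟩ := Piece.mem_verts.mp hu
    obtain ⟨_, h'⟩ := Piece.mem_verts.mp hu'
    exact hne (h.symm.trans h')

lemma sum_card_verts {m : ℕ} (hV : Fintype.card V = m + 1) :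
    ∑ C : Piece G v, C.verts.card = m := by
  have := sum_erase_eq_sum_pieces (G := G) (v := v) fun _ => 1
  simp only [Finset.sum_const, smul_eq_mul, mul_one, Finset.mem_univ,
    Finset.card_erase_of_mem, Finset.card_univ, hV] at this
  omega

/-- For `u ∈ C` and `w` outside the lobe, `d(u,w) ≤ d(u,v) + d(v,w)`. Each `d(v,w)` with `w ∈ C` is
then used `m - |C|` times in either role, and once more in the row of `v`. -/
lemma two_mul_wienerIndex_le_sum_pieces (hG : G.Connected) {m : ℕ} (hV : Fintype.card V = m + 1) :
    2 * wienerIndex G ≤ ∑ C : Piece G v, (∑ u ∈ C.verts, ∑ w ∈ C.lobe, G.dist u w +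
      (2 * (m - C.verts.card) + 1) * ∑ w ∈ C.verts, G.dist v w) := by
  have hcard : ∀ C : Piece G v, C.verts.card ≤ m := fun C =>
    (Finset.single_le_sum (f := fun C : Piece G v => C.verts.card) (fun _ _ => Nat.zero_le _)
      (Finset.mem_univ C)).trans_eq (sum_card_verts hV)
  have hT : ∀ C : Piece G v, ∑ w ∈ C.lobeᶜ, G.dist v w + ∑ w ∈ C.verts, G.dist v w =
      ∑ w, G.dist v w := fun C => by
    rw [← Finset.sum_compl_add_sum C.lobe, Piece.lobe, Finset.sum_insert C.self_notMem_verts,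
      SimpleGraph.dist_self, zero_add]
  have hTs : ∑ w, G.dist v w = ∑ C : Piece G v, ∑ w ∈ C.verts, G.dist v w := by
    rw [← sum_erase_eq_sum_pieces, ← Finset.add_sum_erase _ _ (Finset.mem_univ v),
      SimpleGraph.dist_self, zero_add]
  have hu : ∀ C : Piece G v, ∑ u ∈ C.verts, ∑ w, G.dist u w ≤
      ∑ u ∈ C.verts, ∑ w ∈ C.lobe, G.dist u w + (m - C.verts.card) * ∑ w ∈ C.verts, G.dist v w +
        C.verts.card * ∑ w ∈ C.lobeᶜ, G.dist v w := fun C => by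
    rw [Finset.mul_sum, ← smul_eq_mul (C.verts.card), ← Finset.sum_const, ← Finset.sum_add_distrib,
      ← Finset.sum_add_distrib]
    refine Finset.sum_le_sum fun u _ => ?_
    rw [← Finset.sum_add_sum_compl C.lobe, add_assoc]
    refine Nat.add_le_add_left ?_ _
    have h1 : C.lobeᶜ.card = m - C.verts.card := by
      rw [Finset.card_compl, hV, C.card_lobe]; omega
    rw [← h1, ← smul_eq_mul, ← Finset.sum_const, ← Finset.sum_add_distrib]
    refine Finset.sum_le_sum fun w _ => ?_
    rw [SimpleGraph.dist_comm (u := v) (v := u)]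
    exact hG.dist_triangle
  rw [two_mul_wienerIndex, ← Finset.add_sum_erase _ _ (Finset.mem_univ v),
    sum_erase_eq_sum_pieces (G := G)]
  have h1 := Finset.sum_le_sum fun C (_ : C ∈ (Finset.univ : Finset (Piece G v))) => hu C
  -- Adding `|C|` times the distance sum of `C` to each term turns both sides into `m` times the
  -- total distance from `v`.
  have h2 : ∑ C : Piece G v, C.verts.card * ∑ w ∈ C.lobeᶜ, G.dist v w =
      ∑ C : Piece G v, (m - C.verts.card) * ∑ w ∈ C.verts, G.dist v w := by
    refine Nat.add_right_cancel
      (m := ∑ C : Piece G v, C.verts.card * ∑ w ∈ C.verts, G.dist v w) ?_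
    rw [← Finset.sum_add_distrib, ← Finset.sum_add_distrib]
    simp only [← mul_add, hT, ← add_mul, Nat.sub_add_cancel (hcard _)]
    rw [← Finset.sum_mul, ← Finset.mul_sum, sum_card_verts hV, hTs]
  simp only [Finset.sum_add_distrib] at h1
  simp only [Finset.sum_add_distrib, add_mul, one_mul, mul_assoc, ← Finset.mul_sum]
  omega

end Decomposition
-- The upper bound and its equality case
section Extremal
variable {V : Type*} [Fintype V] [DecidableEq V] {G : SimpleGraph V} {v : V}

lemma wienerIndex_le_and_extremal_piece (hG : G.Connected) (hv : IsCutVertex G v)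
    (hcut : ∀ w, w ≠ v → ¬ IsCutVertex G w) {m : ℕ} (hm : 6 ≤ m)
    (hV : Fintype.card V = m + 1) :
    2 * wienerIndex G ≤ m ^ 2 / 4 * (m + 2) + 2 * m ∧
      (m ^ 2 / 4 * (m + 2) + 2 * m ≤ 2 * wienerIndex G → ∃ C : Piece G v, C.lobe.card = m ∧
        ∀ u ∈ C.lobe, ∑ w ∈ C.lobe, G.dist u w = m ^ 2 / 4) := by
  classical
  have : Fintype (Piece G v) := Fintype.ofFinite _
  have hsum := sum_card_verts (G := G) (v := v) hV
  obtain ⟨t, ht⟩ : ∃ t : Piece G v → ℕ, ∀ C, t C = ∑ u ∈ C.verts, ∑ w ∈ C.lobe, G.dist u w +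
      (2 * (m - C.verts.card) + 1) * ∑ w ∈ C.verts, G.dist v w := ⟨_, fun _ => rfl⟩
  have hW : 2 * wienerIndex G ≤ ∑ C, t C := by
    simpa only [ht] using two_mul_wienerIndex_le_sum_pieces (v := v) hG hV
  -- A cut vertex leaves at least two components.
  have hother : ∀ C : Piece G v, ((Finset.univ : Finset (Piece G v)).erase C).Nonempty := by
    intro C
    by_contra hne
    refine hv fun x y => SimpleGraph.ConnectedComponent.eq.mp ?_
    have h : ∀ C' : Piece G v, C' = C := fun C' => by
      by_contra h
      exact hne ⟨C', by simp [h]⟩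
    exact (h _).trans (h _).symm
  have hsplit : ∀ C : Piece G v,
      C.verts.card + ∑ C' ∈ Finset.univ.erase C, C'.verts.card = m := fun C => by
    rw [← hsum]; exact Finset.add_sum_erase _ (fun C : Piece G v => C.verts.card) (by simp)
  have hle : ∀ C : Piece G v, C.verts.card ≤ m - 1 := fun C => by
    obtain ⟨C', hC'⟩ := hother C
    have := Finset.single_le_sum (f := fun C : Piece G v => C.verts.card)
      (fun _ _ => Nat.zero_le _) hC'
    have := C'.one_le_card_verts
    have := hsplit C
    omega
  have hw : ∀ C : Piece G v, lobeWeight m C.verts.card =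
      C.verts.card * ((C.verts.card + 1) ^ 2 / 4) +
        (2 * (m - C.verts.card) + 1) * ((C.verts.card + 1) ^ 2 / 4) := fun C => by
    have := hle C
    rw [← add_mul, lobeWeight, mul_comm]
    congr 1
    omega
  have hE := Piece.sum_sum_dist_le hG hcut
  have hs := Piece.sum_dist_center_le hG hcut
  have htw : ∀ C, t C ≤ lobeWeight m C.verts.card := fun C => by
    rw [hw, ht]
    exact Nat.add_le_add (hE C) (Nat.mul_le_mul_left _ (hs C))
  have hbound : m ^ 2 / 4 * (m + 2) + 2 * m = lobeWeight m (m - 1) + lobeWeight m 1 := by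
    rw [lobeWeight_one, lobeWeight_pred (by omega)]
  rw [hbound]
  by_cases h : ∃ C : Piece G v, C.verts.card = m - 1
  · obtain ⟨C, hC⟩ := h
    have h1 : ∑ C' ∈ Finset.univ.erase C, C'.verts.card = 1 := by
      have := hsplit C
      omega
    have hcard : ((Finset.univ : Finset (Piece G v)).erase C).card ≤ 1 := h1 ▸ by
      simpa using Finset.card_nsmul_le_sum (Finset.univ.erase C)
        (fun C : Piece G v => C.verts.card) 1 fun C' _ => C'.one_le_card_verts
    obtain ⟨C', hC'⟩ := Finset.card_eq_one.mp (le_antisymm hcard (Finset.card_pos.mpr (hother C)))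
    rw [hC', Finset.sum_singleton] at h1
    rw [← Finset.add_sum_erase _ _ (Finset.mem_univ C), hC', Finset.sum_singleton] at hW
    have hC1 := htw C
    have hC2 := htw C'
    rw [hC] at hC1
    rw [h1] at hC2
    refine ⟨hW.trans (Nat.add_le_add hC1 hC2), fun hge => ⟨C, by rw [C.card_lobe]; omega, ?_⟩⟩
    have heq : lobeWeight m C.verts.card ≤ t C := by rw [hC]; omega
    have hm' : C.verts.card + 1 = m := by omega
    have hE' := hE C
    have hs' := hs C
    rw [hw, ht] at heq
    rw [hm'] at heq hE' hs'
    have hks := Nat.mul_le_mul_left (2 * (m - C.verts.card) + 1) hs'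
    -- Two bounded summands attain the sum of their bounds, so each is tight.
    have hEeq : ∑ u ∈ C.verts, ∑ w ∈ C.lobe, G.dist u w = C.verts.card * (m ^ 2 / 4) := by omega
    have hseq : ∑ w ∈ C.verts, G.dist v w = m ^ 2 / 4 :=
      Nat.eq_of_mul_eq_mul_left (Nat.succ_pos (2 * (m - C.verts.card))) (by
        simp only [Nat.succ_eq_add_one]; omega)
    intro u hu
    rcases Finset.mem_insert.mp hu with rfl | hu
    · rw [← C.sum_dist_center, hseq]
    · rw [← smul_eq_mul, ← Finset.sum_const] at hEeq
      refine (Finset.sum_eq_sum_iff_of_le fun u hu => ?_).mp hEeq u hu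
      rw [← hm', ← C.card_lobe]
      exact C.isLobe.sum_dist_le hG hcut (Finset.mem_insert_of_mem hu)
  · have hlt := sum_lobeWeight_lt_extremal Finset.univ (fun C : Piece G v => C.verts.card) hm
      (fun C _ => C.one_le_card_verts)
      (fun C _ => lt_of_le_of_ne (hle C) fun hC => h ⟨C, hC⟩) hsum
    have := (hW.trans (Finset.sum_le_sum fun C _ => htw C)).trans_lt hlt
    exact ⟨this.le, fun hge => absurd hge this.not_ge⟩

end Extremal

/-! ### Reconstructing the lollipop -/

lemma exists_cyclic_enumeration {W : Type*} [Fintype W] {K : SimpleGraph W}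
    (hK : K.Preconnected) (h2 : ∀ x, (K.neighborSet x).ncard = 2) (v : W) {m : ℕ}
    (hm : Fintype.card W = m) :
    ∃ e : Fin m → W, e.Bijective ∧ (∀ i j : Fin m, (i : ℕ) + 1 = j → K.Adj (e i) (e j)) ∧
      (∀ i j : Fin m, (i : ℕ) = 0 → (j : ℕ) + 1 = m → K.Adj (e i) (e j)) ∧
      ∀ j : Fin m, (j : ℕ) + 1 = m → e j = v := by
  have hne : (K.neighborSet v).Nonempty := Set.nonempty_of_ncard_ne_zero (by simp [h2])
  obtain ⟨p, hp, hsupp⟩ :=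
    SimpleGraph.IsCycles.exists_cycle_toSubgraph_verts_eq_connectedComponentSupp
      (c := K.connectedComponentMk v) (fun x _ => h2 x) rfl hne
  have hmem : ∀ x, x ∈ p.support := fun x => by
    rw [← SimpleGraph.Walk.mem_verts_toSubgraph, hsupp]
    exact SimpleGraph.ConnectedComponent.eq.mpr (hK x v)
  have hpos := hp.three_le_length
  -- The shift by one starts just after `v`, so that the closed walk lists `v` last, as the
  -- attaching vertex `m - 1`.
  have hbij : Function.Bijective fun i : Fin p.length => p.getVert (i + 1) := by
    constructor
    · intro i j h
      have := hp.getVert_injOn (show (i : ℕ) + 1 ∈ {i | 1 ≤ i ∧ i ≤ p.length} by simp)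
        (show (j : ℕ) + 1 ∈ {i | 1 ≤ i ∧ i ≤ p.length} by simp) h
      exact Fin.ext (by omega)
    · intro x
      obtain ⟨k, rfl, hk⟩ := SimpleGraph.Walk.mem_support_iff_exists_getVert.mp (hmem x)
      rcases Nat.eq_zero_or_pos k with rfl | hk0
      · exact ⟨⟨p.length - 1, by omega⟩, by simp [Nat.sub_add_cancel (show 1 ≤ p.length by omega)]⟩
      · exact ⟨⟨k - 1, by omega⟩, by simp [Nat.sub_add_cancel hk0]⟩
  have hcard : p.length = m := by
    rw [← hm, ← Fintype.card_of_bijective hbij, Fintype.card_fin]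
  subst hcard
  refine ⟨_, hbij, fun i j h => ?_, fun i j hi hj => ?_, fun j hj => ?_⟩
  · simp only [← h]
    exact p.adj_getVert_succ (by omega)
  · simp only [hi, hj, SimpleGraph.Walk.getVert_length]
    simpa using (p.adj_getVert_succ (i := 0) (by omega)).symm
  · simp [hj]

/-- Homomorphisms do not increase distances. Equal sums force equality for every pair, and adjacency
means distance one. -/
lemma wienerIndex_le_of_bijective_hom {V W : Type*} [Fintype V] [DecidableEq V] [Fintype W]
    [DecidableEq W] {K : SimpleGraph W} {G : SimpleGraph V} (hK : K.Connected) (φ : K →g G)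
    (hφ : Function.Bijective φ) :
    wienerIndex G ≤ wienerIndex K ∧ (wienerIndex K ≤ wienerIndex G → Nonempty (G ≃g K)) := by
  have hd : ∀ x y, G.dist (φ x) (φ y) ≤ K.dist x y := fun x y => by
    obtain ⟨p, hp⟩ := hK.exists_walk_length_eq_dist x y
    rw [← hp, ← SimpleGraph.Walk.length_map φ]
    exact SimpleGraph.dist_le _
  have hG : 2 * wienerIndex G = ∑ q : W × W, G.dist (φ q.1) (φ q.2) := by
    rw [two_mul_wienerIndex, Fintype.sum_prod_type, ← (Equiv.ofBijective φ hφ).sum_comp]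
    refine Finset.sum_congr rfl fun x _ => ?_
    rw [← (Equiv.ofBijective φ hφ).sum_comp]
    rfl
  have hK2 : 2 * wienerIndex K = ∑ q : W × W, K.dist q.1 q.2 := by
    rw [two_mul_wienerIndex, Fintype.sum_prod_type]
  have hle := Finset.sum_le_sum fun q (_ : q ∈ (Finset.univ : Finset (W × W))) => hd q.1 q.2
  refine ⟨by omega, fun hge => ⟨SimpleGraph.Iso.symm ⟨Equiv.ofBijective φ hφ, ?_⟩⟩⟩
  intro x y
  have := (Finset.sum_eq_sum_iff_of_le fun q (_ : q ∈ (Finset.univ : Finset (W × W))) =>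
    hd q.1 q.2).mp (by omega) (x, y) (Finset.mem_univ _)
  rw [← SimpleGraph.dist_eq_one_iff_adj, ← SimpleGraph.dist_eq_one_iff_adj, ← this]
  rfl

lemma wienerIndex_eq_of_iso {V W : Type*} [Fintype V] [DecidableEq V] [Fintype W] [DecidableEq W]
    {K : SimpleGraph W} {G : SimpleGraph V} (hK : K.Connected) (e : G ≃g K) :
    wienerIndex G = wienerIndex K :=
  le_antisymm (wienerIndex_le_of_bijective_hom hK e.symm.toHom e.symm.bijective).1
    (wienerIndex_le_of_bijective_hom (e.connected_iff.mpr hK) e.toHom e.bijective).1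

/-- The single vertex `z` outside `S` can only be attached to `v`. As `z` is not a cut vertex, `G -
z` is connected, and tight distance sums make it 2-regular. -/
lemma exists_bijective_hom_lollipop {V : Type*} [Fintype V] [DecidableEq V] {G : SimpleGraph V}
    {v : V} {S : Finset V} (hS : IsLobe G v S) (hG : G.Connected)
    (hcut : ∀ w, w ≠ v → ¬ IsCutVertex G w) {m : ℕ} (hm : 4 ≤ m) (hV : Fintype.card V = m + 1)
    (hSm : S.card = m) (hdist : ∀ u ∈ S, ∑ w ∈ S, G.dist u w = m ^ 2 / 4) :
    ∃ φ : lollipop (m + 1) m →g G, Function.Bijective φ := by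
  classical
  obtain ⟨z, hz⟩ : ∃ z, Sᶜ = {z} :=
    Finset.card_eq_one.mp (by rw [Finset.card_compl, hV, hSm]; omega)
  have hmem : ∀ x, x ∈ S ↔ x ≠ z := fun x => by
    rw [← Finset.notMem_compl, hz, Finset.mem_singleton]
  have hvz : v ≠ z := (hmem v).mp hS.mem
  have hadj : G.Adj v z := by
    have : Nontrivial V := ⟨v, z, hvz⟩
    obtain ⟨y, hy⟩ := hG.preconnected.exists_adj_of_nontrivial z
    have := hS.eq_of_adj y ((hmem y).mpr hy.ne') z (by simp [hmem]) hy.symm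
    exact this ▸ hy.symm
  have hK := not_not.mp (hcut z hvz.symm)
  have h2 : ∀ x : ({z}ᶜ : Set V), ((G.induce ({z}ᶜ : Set V)).neighborSet x).ncard = 2 := by
    intro x
    have hx := (hmem x).mpr x.2
    rw [← hS.card_adj_of_sum_dist_eq hG hcut hx (by omega) (by rw [hSm]; exact hdist x hx),
      ← Set.ncard_coe_finset, ← Set.ncard_image_of_injective _ Subtype.val_injective]
    congr 1
    ext y
    simp [hmem]
    tauto
  obtain ⟨e, he, hsucc, hclose, hlast⟩ := exists_cyclic_enumeration hK h2 ⟨v, hvz⟩ (m := m) (by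
    rw [Fintype.card_compl_set, hV]; simp)
  let f : Fin (m + 1) → V := Fin.snoc (α := fun _ => V) (fun i : Fin m => (e i : V)) z
  have hfc : ∀ i : Fin m, f i.castSucc = e i := fun i => Fin.snoc_castSucc (α := fun _ => V) _ _ _
  have hfl : f (Fin.last m) = z := Fin.snoc_last (α := fun _ => V) _ _
  have hrel : ∀ i j : Fin (m + 1), (i : ℕ) + 1 = j ∨ ((i : ℕ) = 0 ∧ (j : ℕ) + 1 = m) →
      G.Adj (f i) (f j) := by
    intro i j h
    induction i using Fin.lastCases with
    | last => have := j.2; simp at h; omega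
    | cast i =>
      induction j using Fin.lastCases with
      | last =>
        rw [hfc, hfl, hlast i (by simp at h; omega)]
        exact hadj
      | cast j =>
        rw [hfc, hfc]
        simp only [Fin.val_castSucc] at h
        rcases h with h | ⟨h1, h2⟩
        · exact hsucc i j h
        · exact hclose i j h1 h2
  refine ⟨⟨f, fun {i j} h => ?_⟩, ?_⟩
  · rcases (lollipop_adj_iff.mp h).2 with h | h
    · exact hrel i j h
    · exact (hrel j i h).symm
  · refine (Fintype.bijective_iff_injective_and_card _).mpr ⟨?_, by simp [hV]⟩
    intro i j h
    change f i = f j at h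
    induction i using Fin.lastCases with
    | last =>
      induction j using Fin.lastCases with
      | last => rfl
      | cast j => rw [hfc, hfl] at h; exact absurd h.symm (e j).2
    | cast i =>
      induction j using Fin.lastCases with
      | last => rw [hfc, hfl] at h; exact absurd h (e i).2
      | cast j => rw [hfc, hfc] at h; rw [he.1 (Subtype.ext h)]

end WienerCut

theorem theorem5p5 {V : Type*} [Fintype V] [DecidableEq V] (n : ℕ) (hn : 7 ≤ n)
    (hV : Fintype.card V = n) (G : SimpleGraph V) (hG : G.Connected)
    (hcut : ∃! v : V, WienerCut.IsCutVertex G v) :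
    WienerCut.wienerIndex G ≤ WienerCut.wienerIndex (WienerCut.lollipop n (n - 1)) ∧
      (WienerCut.wienerIndex G = WienerCut.wienerIndex (WienerCut.lollipop n (n - 1)) ↔
        Nonempty (G ≃g WienerCut.lollipop n (n - 1))) := by
  obtain ⟨m, rfl⟩ : ∃ m, n = m + 1 := ⟨n - 1, by omega⟩
  rw [Nat.add_sub_cancel]
  obtain ⟨v, hv, huniq⟩ := hcut
  have hcut : ∀ w, w ≠ v → ¬ WienerCut.IsCutVertex G w := fun w hw h => hw (huniq w h)
  obtain ⟨hle, hext⟩ := WienerCut.wienerIndex_le_and_extremal_piece hG hv hcut (by omega) hV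
  have hL := WienerCut.le_two_mul_wienerIndex_lollipop (m := m) (by omega)
  refine ⟨by omega, fun h => ?_, fun ⟨e⟩ =>
    WienerCut.wienerIndex_eq_of_iso (WienerCut.lollipop_connected m m) e⟩
  obtain ⟨C, hC, hdist⟩ := hext (by omega)
  obtain ⟨φ, hφ⟩ := WienerCut.exists_bijective_hom_lollipop C.isLobe hG hcut (by omega) hV hC hdist
  exact (WienerCut.wienerIndex_le_of_bijective_hom
    (WienerCut.lollipop_connected m m) φ hφ).2 h.ge
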